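/- All subshifts are two-sided and over finite alphabets: a subshift is a closed shift-invariant subset of a full shift $\mathcal A^{\mathbb Z}$. A code is a continuous shift-commuting map between subshifts; it is right closing (resp. left closing) if it never identifies two distinct points that agree on some $(-\infty,N]$ (resp. on some $[N,\infty)$), and bi-closing if it is both. A shift of finite type (SFT) is a subshift conjugate to the edge shift of a finite directed graph. A subshift is irreducible if it has a point with dense forward orbit, and indecomposable if it is not the union of two disjoint nonempty subshifts. Write $h$ for topological entropy. **Theorem 4.3.** Let $X$ be a subshift, $Y$ an irreducible SFT with $h(X)<h(Y)$, and $\phi:X\to Y$ a bi-closing code. Then the maximum $d=\max\{|\phi^{-1}(y)| : y\in Y\}$ exists and is finite, and the following hold. For $n\in\mathbb N$, let $(\ast)_n$ be the statement: there exist an irreducible SFT $\tilde X\supset X$ (over a finite alphabet containing that of $X$) and an onto code $\tilde\phi:\tilde X\to Y$ with $\tilde\phi|_X=\phi$ such that every point of $Y$ has exactly $n$ preimages under $\tilde\phi$. 1. If $X$ is a nonempty indecomposable SFT, then $(\ast)_n$ holds for all $n\ge d$. 2. If $X$ is an SFT, then $(\ast)_n$ holds for all $n\ge d+1$. 3. For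 an arbitrary subshift $X$, there is an $m\ge d$ such that $(\ast)_n$ holds for all $n\ge m$. -/

import Mathlib

open SymbolicDynamics.FullShift

namespace BiclosingExtension

universe u v

section Subshifts

variable {A : Type u} [TopologicalSpace A] {C : Type v} [TopologicalSpace C]

/-- The shift map `σ` of a two-sided subshift: `(σ x) i = x (1 + i)`. -/
def shiftMap (X : Subshift A ℤ) : X.carrier → X.carrier :=
  (X.mapsTo 1).restrict

/-- The topological entropy `h(X)` of the shift map on `X`. The uniform structure on the
sequence space is the product of the discrete ones, which on a finite alphabet is the one
compatible with the product topology. -/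
noncomputable def entropy (X : Subshift A ℤ) : EReal :=
  letI : UniformSpace A := ⊥
  Dynamics.coverEntropy (shift (1 : ℤ)) X.carrier

/-- A subshift is indecomposable if it is not the union of two disjoint nonempty subshifts. -/
def IsIndecomposable (X : Subshift A ℤ) : Prop :=
  ¬ ∃ X₁ X₂ : Subshift A ℤ, X₁.carrier.Nonempty ∧ X₂.carrier.Nonempty ∧
    Disjoint X₁.carrier X₂.carrier ∧ X.carrier = X₁.carrier ∪ X₂.carrier

/-- A subshift is irreducible if some point of it has a dense forward orbit. -/
def IsIrreducible (X : Subshift A ℤ) : Prop :=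
  ∃ x : X.carrier, Dense (Set.range fun k : ℕ => (shiftMap X)^[k] x)

/-- A code is a continuous shift-commuting map between subshifts. -/
structure IsCode {X : Subshift A ℤ} {Y : Subshift C ℤ} (φ : X.carrier → Y.carrier) : Prop where
  continuous : Continuous φ
  comm : ∀ x, φ (shiftMap X x) = shiftMap Y (φ x)

/-- A conjugacy is a bijective code (its inverse is then a code as well, by compactness). -/
def IsConjugate (X : Subshift A ℤ) (Y : Subshift C ℤ) : Prop :=
  ∃ φ : X.carrier → Y.carrier, IsCode φ ∧ Function.Bijective φ

/-- Two bi-infinite sequences are left asymptotic if they agree on some `(-∞, N]`. -/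
def LeftAsymptotic (x x' : ℤ → A) : Prop := ∃ N : ℤ, ∀ i ≤ N, x i = x' i

/-- Two bi-infinite sequences are right asymptotic if they agree on some `[N, ∞)`. -/
def RightAsymptotic (x x' : ℤ → A) : Prop := ∃ N : ℤ, ∀ i ≥ N, x i = x' i

/-- Right closing: no two distinct left asymptotic points are collapsed. -/
def IsRightClosing {X : Subshift A ℤ} {Y : Subshift C ℤ} (φ : X.carrier → Y.carrier) : Prop :=
  ∀ x x' : X.carrier, LeftAsymptotic x.1 x'.1 → φ x = φ x' → x = x'

/-- Left closing: no two distinct right asymptotic points are collapsed. -/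
def IsLeftClosing {X : Subshift A ℤ} {Y : Subshift C ℤ} (φ : X.carrier → Y.carrier) : Prop :=
  ∀ x x' : X.carrier, RightAsymptotic x.1 x'.1 → φ x = φ x' → x = x'

/-- Bi-closing: left and right closing. -/
def IsBiclosing {X : Subshift A ℤ} {Y : Subshift C ℤ} (φ : X.carrier → Y.carrier) : Prop :=
  IsLeftClosing φ ∧ IsRightClosing φ

end Subshifts

/-- A finite directed graph; loops and multiple edges are allowed. -/
structure FinGraph where
  V : Type
  E : Type
  finiteV : Finite V
  finiteE : Finite E
  src : E → V
  tgt : E → V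

instance (G : FinGraph) : TopologicalSpace G.E := ⊥

instance (G : FinGraph) : DiscreteTopology G.E := ⟨rfl⟩

/-- The edge shift of a graph: the set of all bi-infinite trips on the graph. -/
def edgeShift (G : FinGraph) : Subshift G.E ℤ where
  carrier := {x | ∀ i : ℤ, G.tgt (x i) = G.src (x (i + 1))}
  isClosed := by
    have h : {x : ℤ → G.E | ∀ i : ℤ, G.tgt (x i) = G.src (x (i + 1))} =
        ⋂ i : ℤ, (fun x : ℤ → G.E => (x i, x (i + 1))) ⁻¹' {p | G.tgt p.1 = G.src p.2} := by
      ext x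
      simp
    rw [h]
    exact isClosed_iInter fun i => (isClosed_discrete _).preimage (by fun_prop)
  mapsTo := fun g x hx i => by
    simpa [add_assoc] using hx (g + i)

/-- A shift of finite type is a subshift that is conjugate to an edge shift. -/
def IsSFT {A : Type u} [TopologicalSpace A] (X : Subshift A ℤ) : Prop :=
  ∃ G : FinGraph, IsConjugate X (edgeShift G)

/-- There are an irreducible shift of finite type `X' ⊇ X`, over a finite alphabet `B` that contains
`A` (through the embedding `ι` of letters), and an onto code `φ' : X' → Y` which extends `φ` and is
`n`-to-1, that is, every point of `Y` has exactly `n` preimages. -/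
def HasIrreducibleExtension {A : Type u} [TopologicalSpace A] {C : Type v} [TopologicalSpace C]
    {X : Subshift A ℤ} {Y : Subshift C ℤ} (φ : X.carrier → Y.carrier) (n : ℕ) : Prop :=
  ∃ (B : Type u) (_ : Finite B) (_ : TopologicalSpace B) (_ : DiscreteTopology B) (ι : A ↪ B)
    (X' : Subshift B ℤ) (hX : ∀ x ∈ X.carrier, ι ∘ x ∈ X'.carrier)
    (φ' : X'.carrier → Y.carrier),
    IsSFT X' ∧ IsIrreducible X' ∧ IsCode φ' ∧
      (∀ x : X.carrier, φ' ⟨ι ∘ x.1, hX x.1 x.2⟩ = φ x) ∧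
      Function.Surjective φ' ∧ ∀ y : Y.carrier, (φ' ⁻¹' {y}).encard = n

end BiclosingExtension

/-!
By compactness the bi-closing code `φ` has bounded fibres, and its fibres can be labelled
injectively and continuously by any set `L` of at least `d` labels. On each fibre the shift moves
the labels by a partial injection of `L`, which depends only on a window of `φ x`. Recoding `Y` as
the edge shift of a strongly connected graph whose edges determine that window, these partial
injections live on edges; completing them to permutations gives a skew product of the graph with
`L`, whose edge shift is `|L|`-to-one over `Y` and contains a copy of `X`.

The skew product must also be strongly connected. Since `h(X) < h(Y)`, some
point of `Y` has no preimage in `X`, so that the permutation on one edge is unconstrained, and it is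
chosen so as to merge all the components. A final change of alphabet turns the copy of `X` into `X`
itself.
-/

namespace BiclosingExtension

section Subshifts

variable {A C D : Type*} [TopologicalSpace A] [TopologicalSpace C] [TopologicalSpace D]
  {X : Subshift A ℤ} {Y : Subshift C ℤ} {Z : Subshift D ℤ} {φ : X.carrier → Y.carrier}

/-- The power `σ ^ t` of the shift map of a subshift, for `t : ℤ`. -/
def translate (X : Subshift A ℤ) (t : ℤ) : X.carrier → X.carrier :=
  (X.mapsTo t).restrict

@[simp] lemma translate_apply (t : ℤ) (x : X.carrier) (i : ℤ) :
    (translate X t x).1 i = x.1 (t + i) := rfl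

lemma shiftMap_eq_translate : shiftMap X = translate X 1 := rfl

lemma translate_translate (s t : ℤ) (x : X.carrier) :
    translate X s (translate X t x) = translate X (t + s) x := by
  ext i
  simp [add_assoc]

@[simp] lemma translate_zero (x : X.carrier) : translate X 0 x = x := by
  ext i
  simp

lemma bijective_translate (t : ℤ) : Function.Bijective (translate X t) :=
  Function.bijective_iff_has_inverse.mpr
    ⟨translate X (-t), fun x => by simp [translate_translate],
      fun x => by simp [translate_translate]⟩

lemma iterate_shiftMap (k : ℕ) (x : X.carrier) : (shiftMap X)^[k] x = translate X k x := by
  induction k with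
  | zero => simp
  | succ k ih =>
    rw [Function.iterate_succ_apply', ih, shiftMap_eq_translate, translate_translate]
    push_cast
    rfl

@[fun_prop]
lemma continuous_translate (t : ℤ) : Continuous (translate X t) :=
  (continuous_shift t).restrict (X.mapsTo t)

lemma continuous_coord (X : Subshift A ℤ) (i : ℤ) : Continuous fun x : X.carrier => x.1 i :=
  (continuous_apply i).comp continuous_subtype_val

instance [Finite A] (X : Subshift A ℤ) : CompactSpace X.carrier :=
  isCompact_iff_compactSpace.mp X.isClosed.isCompact

lemma isCode_translate (t : ℤ) : IsCode (translate X t) :=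
  ⟨continuous_translate t, fun x => by
    simp only [shiftMap_eq_translate, translate_translate, add_comm]⟩

lemma IsCode.comp {ψ : Y.carrier → Z.carrier} (hψ : IsCode ψ) (hφ : IsCode φ) : IsCode (ψ ∘ φ) :=
  ⟨hψ.continuous.comp hφ.continuous, fun x => by simp [hφ.comm, hψ.comm]⟩

lemma IsCode.map_translate (hφ : IsCode φ) (t : ℤ) (x : X.carrier) :
    φ (translate X t x) = translate Y t (φ x) := by
  have forward (k : ℕ) (x : X.carrier) : φ (translate X k x) = translate Y k (φ x) := by
    simp only [← iterate_shiftMap]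
    exact Function.Semiconj.iterate_right (f := φ) hφ.comm k x
  obtain ⟨k, rfl | rfl⟩ := t.eq_nat_or_neg
  · exact forward k x
  · apply (bijective_translate k).injective
    rw [← forward, translate_translate, translate_translate, neg_add_cancel, translate_zero,
      translate_zero]

lemma IsCode.exists_inverse [Finite A] [T2Space C] (hφ : IsCode φ) (hb : Function.Bijective φ) :
    ∃ ψ : Y.carrier → X.carrier, IsCode ψ ∧ Function.LeftInverse ψ φ ∧
      Function.RightInverse ψ φ := by
  obtain ⟨ψ, hl, hr⟩ := Function.bijective_iff_has_inverse.mp hb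
  let e : X.carrier ≃ Y.carrier := ⟨φ, ψ, hl, hr⟩
  exact ⟨ψ, ⟨hφ.continuous.continuous_symm_of_equiv_compact_to_t2 (f := e),
    fun y => hb.injective (by rw [hr, hφ.comm, hr])⟩, hl, hr⟩

lemma IsIrreducible.of_surjective (hX : IsIrreducible X) (hφ : IsCode φ)
    (hs : Function.Surjective φ) : IsIrreducible Y := by
  obtain ⟨x, hx⟩ := hX
  refine ⟨φ x, ?_⟩
  have horbit : (fun k : ℕ => (shiftMap Y)^[k] (φ x)) = φ ∘ fun k : ℕ => (shiftMap X)^[k] x := by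
    funext k
    simp only [iterate_shiftMap, Function.comp, hφ.map_translate]
  rw [horbit]
  exact hs.denseRange.comp hx hφ.continuous

end Subshifts

lemma entropy_le_of_surjective {A C : Type*} [TopologicalSpace A] [DiscreteTopology A] [Finite A]
    [TopologicalSpace C] [DiscreteTopology C] {X : Subshift A ℤ} {Y : Subshift C ℤ}
    {φ : X.carrier → Y.carrier} (hφ : IsCode φ) (hs : Function.Surjective φ) :
    entropy Y ≤ entropy X := by
  obtain rfl := DiscreteTopology.eq_bot (α := A)
  obtain rfl := DiscreteTopology.eq_bot (α := C)
  let _ : UniformSpace A := ⊥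
  let _ : UniformSpace C := ⊥
  have h := Dynamics.coverEntropy_image_le_of_uniformContinuous (S := shiftMap X)
    (T := shiftMap Y) hφ.comm (CompactSpace.uniformContinuous_of_continuous hφ.continuous) Set.univ
  rw [Set.image_univ, hs.range_eq] at h
  have hX := Dynamics.coverEntropy_restrict (X.mapsTo 1)
  have hY := Dynamics.coverEntropy_restrict (Y.mapsTo 1)
  exact (hY.symm.trans_le h).trans_eq hX

section Windows

/-- The central window `[-r, r]` of coordinates. The block of a sequence `x` on it is
`(window r).domRestrict x`. -/
abbrev window (r : ℕ) : Set ℤ := Set.Icc (-r) r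

lemma mem_window_natAbs (j : ℤ) : j ∈ window j.natAbs := ⟨by omega, by omega⟩

lemma window_mono {r s : ℕ} (h : r ≤ s) : window r ⊆ window s :=
  Set.Icc_subset_Icc (by omega) (by omega)

variable {T A D : Type*} [TopologicalSpace T] [CompactSpace T] [TopologicalSpace A] [T2Space A]
  {f g : T → ℤ → A}

lemma exists_window_forall_not_eqOn (hf : Continuous f) (hg : Continuous g) {S : Set T}
    (hS : IsClosed S) (h : ∀ t ∈ S, f t ≠ g t) :
    ∃ r : ℕ, ∀ t ∈ S, ¬ Set.EqOn (f t) (g t) (window r) := by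
  have hclosed (r : ℕ) : IsClosed {t | Set.EqOn (f t) (g t) (window r)} := by
    simp only [Set.EqOn, Set.ofPred_forall]
    exact isClosed_biInter fun j _ => isClosed_eq ((continuous_apply j).comp hf)
      ((continuous_apply j).comp hg)
  obtain ⟨r, hr⟩ := hS.isCompact.elim_directed_family_closed
    (fun r => {t | Set.EqOn (f t) (g t) (window r)}) hclosed
    (by
      refine Set.eq_empty_of_forall_notMem fun t ⟨htS, ht⟩ => h t htS (funext fun j => ?_)
      exact Set.mem_iInter.mp ht j.natAbs (mem_window_natAbs j))
    (directed_of_isDirected_le fun r s hrs t ht => Set.EqOn.mono (window_mono hrs) ht)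
  exact ⟨r, fun t ht he => hr.subset ⟨ht, he⟩⟩

lemma exists_window_eq_of_factorsThrough [TopologicalSpace D] [DiscreteTopology D]
    (hf : Continuous f) {k : T → D} (hk : Continuous k) (h : k.FactorsThrough f) :
    ∃ r : ℕ, ∀ t t', Set.EqOn (f t) (f t') (window r) → k t = k t' := by
  obtain ⟨r, hr⟩ := exists_window_forall_not_eqOn (T := T × T) (f := f ∘ Prod.fst)
    (g := f ∘ Prod.snd) (by fun_prop) (by fun_prop) (S := {p | k p.1 ≠ k p.2})
    ((isClosed_discrete {q : D × D | q.1 ≠ q.2}).preimage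
      (f := fun p : T × T => (k p.1, k p.2)) (by fun_prop))
    (fun _ hp he => hp (h he))
  exact ⟨r, fun t t' ht => by_contra fun hne => hr (t, t') hne ht⟩

lemma exists_window_forall_mem_of_isOpen (hf : Continuous f) (hinj : Function.Injective f)
    {U : Set T} (hU : IsOpen U) {t : T} (ht : t ∈ U) :
    ∃ r : ℕ, ∀ s, Set.EqOn (f s) (f t) (window r) → s ∈ U := by
  obtain ⟨r, hr⟩ := exists_window_forall_not_eqOn hf (g := fun _ => f t) continuous_const
    hU.isClosed_compl (fun s hs he => hs (hinj he ▸ ht))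
  exact ⟨r, fun s hs => by_contra fun h => hr s h hs⟩

end Windows

section Closing

variable {A C : Type*} [TopologicalSpace A] [DiscreteTopology A] [Finite A]
  [TopologicalSpace C] [T2Space C] {X : Subshift A ℤ} {Y : Subshift C ℤ} {φ : X.carrier → Y.carrier}

-- The direction of time is the sign of `e`, so that `e = 1` and `e = -1` serve right and left
-- closing codes respectively.
lemma exists_forall_eq_of_eq_segment (hφ : IsCode φ) {e : ℤ}
    (h : ∀ x x' : X.carrier, φ x = φ x' → (∀ j ≤ 0, x.1 (e * j) = x'.1 (e * j)) →
      x.1 e = x'.1 e) :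
    ∃ N : ℕ, ∀ x x' : X.carrier, φ x = φ x' →
      (∀ j ∈ Set.Icc (-N : ℤ) 0, x.1 (e * j) = x'.1 (e * j)) →
        ∀ j ≥ 0, x.1 (e * j) = x'.1 (e * j) := by
  have hcont := hφ.continuous
  have hcoord := continuous_coord X
  obtain ⟨N, hN⟩ := exists_window_forall_not_eqOn (T := X.carrier × X.carrier)
    (f := fun p j => p.1.1 (e * -|j|)) (g := fun p j => p.2.1 (e * -|j|))
    (continuous_pi fun j => (hcoord _).comp continuous_fst)
    (continuous_pi fun j => (hcoord _).comp continuous_snd)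
    (S := {p | φ p.1 = φ p.2} ∩ {p | p.1.1 e ≠ p.2.1 e})
    ((isClosed_eq (by fun_prop) (by fun_prop)).inter
      ((isClosed_discrete {q : A × A | q.1 ≠ q.2}).preimage ((hcoord e).prodMap (hcoord e))))
    (fun p hp he => hp.2 (h _ _ hp.1 fun j hj => by
      simpa [abs_of_nonpos hj] using congrFun he j))
  refine ⟨N, fun x x' he hx => ?_⟩
  have extend (m : ℕ) : ∀ j ∈ Set.Icc (-N : ℤ) m, x.1 (e * j) = x'.1 (e * j) := by
    induction m with
    | zero => exact hx
    | succ m ih =>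
      rintro j ⟨hj, hjm⟩
      rcases (show j ≤ m ∨ j = m + 1 by push_cast at hjm; omega) with hj' | rfl
      · exact ih j ⟨hj, hj'⟩
      · by_contra hne
        refine hN (translate X (e * m) x, translate X (e * m) x')
          ⟨by simp [hφ.map_translate, he], by simpa [mul_add] using hne⟩ fun i hi => ?_
        simpa [mul_add] using ih (m + -|i|) (by
          have := abs_le.mpr hi
          exact ⟨by omega, by have := abs_nonneg i; omega⟩)
  exact fun j hj => extend j.natAbs j ⟨by omega, by omega⟩

lemma IsBiclosing.exists_window (hφ : IsCode φ) (h : IsBiclosing φ) :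
    ∃ N : ℕ, ∀ x x' : X.carrier, φ x = φ x' → Set.EqOn x.1 x'.1 (window N) → x = x' := by
  obtain ⟨N₁, h₁⟩ := exists_forall_eq_of_eq_segment hφ (e := -1) fun x x' he hx => by
    rw [h.1 x x' ⟨0, fun i hi => by simpa using hx (-i) (by omega)⟩ he]
  obtain ⟨N₂, h₂⟩ := exists_forall_eq_of_eq_segment hφ (e := 1) fun x x' he hx => by
    rw [h.2 x x' ⟨0, fun i hi => by simpa using hx i hi⟩ he]
  refine ⟨max N₁ N₂, fun x x' he hx => Subtype.ext (funext fun j => ?_)⟩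
  rcases le_total j 0 with hj | hj
  · simpa using h₁ x x' he (fun i ⟨hi, _⟩ => hx ⟨by omega, by omega⟩) (-j) (by omega)
  · simpa using h₂ x x' he (fun i ⟨hi, _⟩ => hx ⟨by omega, by omega⟩) j hj

lemma IsBiclosing.exists_encard_fiber_le (hφ : IsCode φ) (h : IsBiclosing φ) :
    ∃ c : ℕ, ∀ y, (φ ⁻¹' {y}).encard ≤ c := by
  obtain ⟨N, hN⟩ := h.exists_window hφ
  refine ⟨Nat.card (window N → A), fun y => ?_⟩
  have hinj : Set.InjOn (fun x : X.carrier => (window N).domRestrict x.1) (φ ⁻¹' {y}) :=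
    fun x hx x' hx' he => hN x x' (hx.trans hx'.symm) (Set.domRestrict_eq_domRestrict_iff.mp he)
  rw [← hinj.encard_image, ← ENat.card_eq_coe_natCard, ← Set.encard_univ]
  exact Set.encard_le_encard (Set.subset_univ _)

lemma IsBiclosing.exists_isGreatest_encard_fiber [Nonempty Y.carrier] (hφ : IsCode φ)
    (h : IsBiclosing φ) :
    ∃ d : ℕ, IsGreatest (Set.range fun y : Y.carrier => (φ ⁻¹' {y}).encard) (d : ℕ∞) := by
  obtain ⟨c, hc⟩ := h.exists_encard_fiber_le hφ
  have hlt : sSup (Set.range fun y : Y.carrier => (φ ⁻¹' {y}).encard) < ⊤ :=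
    (sSup_le (Set.forall_mem_range.mpr hc)).trans_lt (ENat.natCast_lt_top c)
  obtain ⟨d, hd⟩ := ENat.ne_top_iff_exists.mp hlt.ne
  exact ⟨d, hd ▸ ⟨ENat.sSup_mem_of_nonempty_of_lt_top hlt, fun _ => le_sSup⟩⟩

/-- A continuous labelling of the points of `X` that tells apart the points of every fibre
of `φ`. -/
structure IsFiberLabelling {L : Type*} [TopologicalSpace L] (φ : X.carrier → Y.carrier)
    (l : X.carrier → L) : Prop where
  continuous : Continuous l
  injOn : ∀ y, Set.InjOn l (φ ⁻¹' {y})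

lemma exists_window_encard_image_le {T S : Type*} [TopologicalSpace T] [CompactSpace T]
    [TopologicalSpace S] [DiscreteTopology S] {f : T → ℤ → C} (hf : Continuous f)
    {k : T → S} (hk : Continuous k) {d : ℕ} (hd : ∀ y, (k '' (f ⁻¹' {y})).encard ≤ d) :
    ∃ r : ℕ, ∀ b, (k '' {t | (window r).domRestrict (f t) = b}).encard ≤ d := by
  obtain ⟨r, hr⟩ := exists_window_forall_not_eqOn (T := Fin (d + 1) → T)
    (f := fun p j i => f (p i) j) (g := fun p j _ => f (p 0) j) (by fun_prop) (by fun_prop)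
    (S := {p | Function.Injective (k ∘ p)})
    ((isClosed_discrete {q : Fin (d + 1) → S | Function.Injective q}).preimage
      (f := fun p => k ∘ p) (by fun_prop))
    (fun p hp he => by
      have hrange : Set.range (k ∘ p) ⊆ k '' (f ⁻¹' {f (p 0)}) := by
        rintro _ ⟨i, rfl⟩
        exact ⟨p i, funext fun j => congrFun (congrFun he j) i, rfl⟩
      have hcard := (Set.encard_le_encard hrange).trans (hd _)
      rw [← Set.image_univ, hp.encard_image, Set.encard_univ, ENat.card_eq_coe_natCard,
        Nat.card_fin] at hcard
      exact absurd (ENat.natCast_le_natCast.mp hcard) (by omega))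
  refine ⟨r, fun b => not_lt.mp fun hlt => ?_⟩
  have : Nonempty S := ⟨(Set.encard_pos.mp (bot_le.trans_lt hlt)).choose⟩
  obtain ⟨q, hq, hqinj⟩ := (Set.finite_univ (α := Fin (d + 1))).exists_injOn_of_encard_le
    (by simpa [ENat.card_eq_coe_natCard] using Order.add_one_le_of_lt hlt)
  choose p hpb hpq using fun i => hq (Set.mem_univ i)
  refine hr p ?_ fun j hj => funext fun i =>
    Set.domRestrict_eq_domRestrict_iff.mp ((hpb i).trans (hpb 0).symm) hj
  rwa [Set.mem_ofPred_eq, show k ∘ p = q from funext hpq, ← Set.injOn_univ]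

lemma IsBiclosing.exists_isFiberLabelling (hφ : IsCode φ) (h : IsBiclosing φ)
    [DiscreteTopology C] {L : Type*} [TopologicalSpace L] [Finite L] [Nonempty L]
    (hcard : ∀ y, (φ ⁻¹' {y}).encard ≤ Nat.card L) :
    ∃ l : X.carrier → L, IsFiberLabelling φ l := by
  obtain ⟨N, hN⟩ := h.exists_window hφ
  let k : X.carrier → window N → A := fun x => (window N).domRestrict x.1
  have hk : Continuous k := (Pi.continuous_domRestrict _).comp continuous_subtype_val
  have hfiber (y : ℤ → C) : (k '' ((fun x => (φ x).1) ⁻¹' {y})).encard ≤ Nat.card L := by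
    refine (Set.encard_image_le _ _).trans ?_
    by_cases hy : y ∈ Y.carrier
    · exact (congrArg Set.encard (by ext; simp [Subtype.ext_iff])).trans_le (hcard ⟨y, hy⟩)
    · rw [Set.preimage_singleton_eq_empty.mpr (by rintro ⟨x, rfl⟩; exact hy (φ x).2)]
      simp
  have hφ' : Continuous fun x => (φ x).1 := continuous_subtype_val.comp hφ.continuous
  obtain ⟨r, hr⟩ := exists_window_encard_image_le hφ' hk hfiber
  choose g _ hg using fun b => (Set.toFinite _).exists_injOn_of_encard_le (β := L)
    (t := Set.univ) ((hr b).trans_eq (by simp [ENat.card_eq_coe_natCard]))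
  refine ⟨fun x => g ((window r).domRestrict (φ x).1) (k x), ?_, fun y x hx x' hx' he => ?_⟩
  · exact (continuous_of_discreteTopology (f := fun q : (window r → C) × (window N → A) =>
      g q.1 q.2)).comp (((Pi.continuous_domRestrict _).comp hφ').prodMk hk)
  · obtain rfl : φ x = y := hx
    obtain hx' : φ x' = φ x := hx'
    refine hN x x' hx'.symm (Set.domRestrict_eq_domRestrict_iff.mp
      (hg _ ⟨x, rfl, rfl⟩ ⟨x', ?_, rfl⟩ ?_))
    · exact congrArg (fun y => (window r).domRestrict y.1) hx'
    · simpa only [hx'] using he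

end Closing

instance (G : FinGraph) : Finite G.E := G.finiteE

instance (G : FinGraph) : Finite G.V := G.finiteV

lemma exists_perm_of_biUnique {L : Type*} [Finite L] {R : L → L → Prop}
    (hR : Relator.BiUnique R) : ∃ σ : Equiv.Perm L, ∀ i j, R i j → σ i = j := by
  classical
  choose f hf using fun i : {i // ∃ j, R i j} => i.2
  have hbij : Function.Bijective fun i => (⟨f i, i, hf i⟩ : {j // ∃ i, R i j}) := by
    refine ⟨fun i i' h => ?_, fun ⟨j, i, hij⟩ => ⟨⟨i, j, hij⟩, ?_⟩⟩
    · have h' : f i = f i' := congrArg Subtype.val h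
      exact Subtype.ext (hR.1 (hf i) (h' ▸ hf i'))
    · exact Subtype.ext (hR.2 (hf _) hij)
  refine ⟨(Equiv.ofBijective _ hbij).extendSubtype, fun i j hij => ?_⟩
  rw [Equiv.extendSubtype_apply_of_mem _ i ⟨j, hij⟩]
  exact hR.2 (hf _) hij

namespace FinGraph

open Relation

/-- Reachability of the second vertex from the first by a directed path. -/
def Reachable (G : FinGraph) : G.V → G.V → Prop :=
  ReflTransGen fun v w => ∃ e, G.src e = v ∧ G.tgt e = w

lemma reachable_edge (G : FinGraph) (e : G.E) : G.Reachable (G.src e) (G.tgt e) :=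
  ReflTransGen.single ⟨e, rfl, rfl⟩

/-- A graph is strongly connected if each vertex can be reached from each vertex. -/
def StronglyConnected (G : FinGraph) : Prop := ∀ v w, G.Reachable v w

/-- The skew product of `G` with permutations `π` of a set `L` of labels: the covering graph of `G`
with fibre `L` in which the lift of the edge `e` starting at label `i` ends at label `π e i`. -/
def skewProduct (G : FinGraph) {L : Type} [Finite L] (π : G.E → Equiv.Perm L) : FinGraph where
  V := G.V × L
  E := G.E × L
  finiteV := inferInstance
  finiteE := inferInstance
  src p := (G.src p.1, p.2)
  tgt p := (G.tgt p.1, π p.1 p.2)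

section SwapTargets

variable {G : FinGraph} {L : Type*} [DecidableEq G.E] [DecidableEq L]

/-- Interchange the targets of the lifts `(e₀, i)` and `(e₀, i')` of the edge `e₀` to the skew
product with `π`. -/
def swapTargets (π : G.E → Equiv.Perm L) (e₀ : G.E) (i i' : L) : G.E → Equiv.Perm L :=
  Function.update π e₀ (π e₀ * Equiv.swap i i')

lemma swapTargets_comm (π : G.E → Equiv.Perm L) (e₀ : G.E) (i i' : L) :
    swapTargets π e₀ i' i = swapTargets π e₀ i i' := by
  simp only [swapTargets, Equiv.swap_comm]

lemma swapTargets_apply_of_ne {π : G.E → Equiv.Perm L} {e₀ : G.E} {i i' : L} {e : G.E} {j : L}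
    (h : ¬ (e = e₀ ∧ (j = i ∨ j = i'))) :
    swapTargets π e₀ i i' e j = π e j := by
  by_cases he : e = e₀
  · subst he
    simp only [true_and, not_or] at h
    simp [swapTargets, Equiv.swap_apply_of_ne_of_ne h.1 h.2]
  · simp [swapTargets, he]

end SwapTargets

variable {G : FinGraph} {L : Type} [Finite L]

lemma reachable_skewProduct_edge (π : G.E → Equiv.Perm L) (e : G.E) (i : L) :
    (G.skewProduct π).Reachable (G.src e, i) (G.tgt e, π e i) :=
  (G.skewProduct π).reachable_edge (e, i)

lemma Reachable.exists_lift {v w : G.V} (h : G.Reachable v w) (π : G.E → Equiv.Perm L) (i : L) :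
    ∃ j, (G.skewProduct π).Reachable (v, i) (w, j) := by
  induction h with
  | refl => exact ⟨i, ReflTransGen.refl⟩
  | tail _ he ih =>
    obtain ⟨j, hj⟩ := ih
    obtain ⟨e, rfl, rfl⟩ := he
    exact ⟨π e j, hj.trans (reachable_skewProduct_edge π e j)⟩

-- The cardinality of `S v` cannot decrease along a path, hence is constant.
lemma StronglyConnected.image_eq_of_mapsTo (hG : G.StronglyConnected) {π : G.E → Equiv.Perm L}
    {S : G.V → Set L} (hS : ∀ e, Set.MapsTo (π e) (S (G.src e)) (S (G.tgt e))) (e : G.E) :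
    π e '' S (G.src e) = S (G.tgt e) := by
  have hcard (v w : G.V) : (S v).ncard ≤ (S w).ncard := by
    induction hG v w with
    | refl => exact le_rfl
    | tail _ he ih =>
      obtain ⟨f, rfl, rfl⟩ := he
      exact ih.trans (Set.ncard_le_ncard_of_injOn _ (hS f) (π f).injective.injOn)
  refine Set.eq_of_subset_of_ncard_le (hS e).image_subset ?_
  rw [Set.ncard_image_of_injective _ (π e).injective]
  exact hcard _ _

lemma StronglyConnected.reachable_skewProduct_symm (hG : G.StronglyConnected)
    {π : G.E → Equiv.Perm L} {p q : G.V × L} (h : (G.skewProduct π).Reachable p q) :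
    (G.skewProduct π).Reachable q p := by
  induction h with
  | refl => exact ReflTransGen.refl
  | tail _ hs ih =>
    refine ReflTransGen.trans ?_ ih
    obtain ⟨⟨e, i⟩, rfl, rfl⟩ := hs
    let S (w : G.V) : Set L := {j | (G.skewProduct π).Reachable (G.tgt e, π e i) (w, j)}
    have hS (f : G.E) : Set.MapsTo (π f) (S (G.src f)) (S (G.tgt f)) :=
      fun j hj => ReflTransGen.trans hj (reachable_skewProduct_edge π f j)
    have hi : π e i ∈ π e '' S (G.src e) :=
      hG.image_eq_of_mapsTo hS e ▸ (ReflTransGen.refl : _ ∈ S (G.tgt e))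
    exact (π e).injective.mem_set_image.mp hi

section SwapTargets

variable [DecidableEq G.E] [DecidableEq L] {π : G.E → Equiv.Perm L} {e₀ : G.E} {i i' : L}

lemma reachable_swapTargets_edge {e : G.E} {j : L} (h : ¬ (e = e₀ ∧ (j = i ∨ j = i'))) :
    (G.skewProduct (swapTargets π e₀ i i')).Reachable (G.src e, j) (G.tgt e, π e j) := by
  rw [← swapTargets_apply_of_ne h]
  exact reachable_skewProduct_edge _ e j

-- Up to its first visit to `(src e₀, i)` a path avoids both swapped edges.
lemma reachable_swapTargets_src
    (h : ¬ (G.skewProduct π).Reachable (G.src e₀, i') (G.src e₀, i)) {p : G.V × L}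
    (hp : (G.skewProduct π).Reachable p (G.src e₀, i)) :
    (G.skewProduct (swapTargets π e₀ i i')).Reachable p (G.src e₀, i) := by
  induction hp using ReflTransGen.head_induction_on with
  | refl => exact ReflTransGen.refl
  | head hs hb ih =>
    obtain ⟨⟨e, j⟩, rfl, rfl⟩ := hs
    by_cases hc : e = e₀ ∧ (j = i ∨ j = i')
    · obtain ⟨rfl, rfl | rfl⟩ := hc
      · exact ReflTransGen.refl
      · exact absurd (ReflTransGen.head ⟨(e, j), rfl, rfl⟩ hb) h
    · exact (reachable_swapTargets_edge hc).trans ih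

variable (hG : G.StronglyConnected)
  (h : ¬ (G.skewProduct π).Reachable (G.src e₀, i) (G.src e₀, i'))
include hG h

lemma StronglyConnected.reachable_swapTargets_tgt :
    (G.skewProduct (swapTargets π e₀ i i')).Reachable (G.tgt e₀, π e₀ i) (G.src e₀, i) ∧
      (G.skewProduct (swapTargets π e₀ i i')).Reachable (G.tgt e₀, π e₀ i') (G.src e₀, i') := by
  refine ⟨reachable_swapTargets_src (fun h' => h (hG.reachable_skewProduct_symm h'))
    (hG.reachable_skewProduct_symm (reachable_skewProduct_edge π e₀ i)), ?_⟩
  rw [← swapTargets_comm]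
  exact reachable_swapTargets_src h
    (hG.reachable_skewProduct_symm (reachable_skewProduct_edge π e₀ i'))

lemma StronglyConnected.reachable_swapTargets {p q : G.V × L}
    (hpq : (G.skewProduct π).Reachable p q) :
    (G.skewProduct (swapTargets π e₀ i i')).Reachable p q := by
  obtain ⟨h₁, h₂⟩ := hG.reachable_swapTargets_tgt h
  induction hpq with
  | refl => exact ReflTransGen.refl
  | tail _ hs ih =>
    refine ReflTransGen.trans ih ?_
    obtain ⟨⟨e, j⟩, rfl, rfl⟩ := hs
    by_cases hc : e = e₀ ∧ (j = i ∨ j = i')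
    · obtain ⟨rfl, rfl | rfl⟩ := hc
      · exact hG.reachable_skewProduct_symm h₁
      · exact hG.reachable_skewProduct_symm h₂
    · exact reachable_swapTargets_edge hc

lemma StronglyConnected.reachable_swapTargets_src_src :
    (G.skewProduct (swapTargets π e₀ i i')).Reachable (G.src e₀, i) (G.src e₀, i') := by
  have hedge := reachable_skewProduct_edge (swapTargets π e₀ i i') e₀ i
  rw [show swapTargets π e₀ i i' e₀ i = π e₀ i' by simp [swapTargets]] at hedge
  exact hedge.trans (hG.reachable_swapTargets_tgt h).2

end SwapTargets

lemma StronglyConnected.exists_skewProduct_reachable (hG : G.StronglyConnected)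
    {R : G.E → L → L → Prop} (hR : ∀ e, Relator.BiUnique (R e)) :
    ∃ π : G.E → Equiv.Perm L, (∀ e i j, R e i j → π e i = j) ∧
      ∀ e i i', (∀ j, ¬ R e i j) → (∀ j, ¬ R e i' j) →
        (G.skewProduct π).Reachable (G.src e, i) (G.src e, i') := by
  classical
  choose π₀ hπ₀ using fun e => exists_perm_of_biUnique (hR e)
  let c (π : G.E → Equiv.Perm L) : ℕ :=
    {x : (G.V × L) × (G.V × L) | (G.skewProduct π).Reachable x.1 x.2}.ncard
  obtain ⟨π, hπ, hmax⟩ := Set.exists_max_image {π : G.E → Equiv.Perm L |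
    ∀ e i j, R e i j → π e i = j} c (Set.toFinite _) ⟨π₀, hπ₀⟩
  refine ⟨π, hπ, fun e i i' hi hi' => by_contra fun hne => ?_⟩
  have hext : ∀ f k j, R f k j → swapTargets π e i i' f k = j := fun f k j hk => by
    rw [swapTargets_apply_of_ne, hπ f k j hk]
    rintro ⟨rfl, rfl | rfl⟩
    exacts [hi j hk, hi' j hk]
  have hlt : c π < c (swapTargets π e i i') := by
    refine Set.ncard_lt_ncard (Set.ssubset_iff_of_subset ?_ |>.mpr
      ⟨((G.src e, i), (G.src e, i')), hG.reachable_swapTargets_src_src hne, hne⟩)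
    exact fun x hx => hG.reachable_swapTargets hne hx
  exact (hmax _ hext).not_gt hlt

lemma StronglyConnected.exists_stronglyConnected_skewProduct (hG : G.StronglyConnected)
    {R : G.E → L → L → Prop} (hR : ∀ e, Relator.BiUnique (R e)) {e₀ : G.E}
    (he₀ : ∀ i j, ¬ R e₀ i j) :
    ∃ π : G.E → Equiv.Perm L, (∀ e i j, R e i j → π e i = j) ∧
      (G.skewProduct π).StronglyConnected := by
  obtain ⟨π, hπ, hfree⟩ := hG.exists_skewProduct_reachable hR
  refine ⟨π, hπ, fun ⟨v, i⟩ ⟨w, j⟩ => ?_⟩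
  obtain ⟨i', hi⟩ := (hG v (G.src e₀)).exists_lift π i
  obtain ⟨j', hj⟩ := (hG w (G.src e₀)).exists_lift π j
  exact (hi.trans (hfree e₀ i' j' (he₀ i') (he₀ j'))).trans (hG.reachable_skewProduct_symm hj)

end FinGraph

lemma exists_dense_range_iterate {T : Type*} [TopologicalSpace T] [SecondCountableTopology T]
    [BaireSpace T] [Nonempty T] {f : T → T} (hf : Continuous f)
    (h : ∀ U W : Set T, IsOpen U → U.Nonempty → IsOpen W → W.Nonempty →
      ∃ k : ℕ, (W ∩ f^[k] ⁻¹' U).Nonempty) :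
    ∃ x, Dense (Set.range fun k : ℕ => f^[k] x) := by
  let 𝓑 := TopologicalSpace.countableBasis T
  have hopen {U : Set T} (hU : U ∈ 𝓑) : IsOpen U := TopologicalSpace.isOpen_of_mem_countableBasis hU
  have hdense : Dense (⋂ U ∈ 𝓑, ⋃ k : ℕ, f^[k] ⁻¹' U) := by
    refine dense_biInter_of_isOpen
      (fun U hU => isOpen_iUnion fun k => (hopen hU).preimage (hf.iterate k))
      (TopologicalSpace.countable_countableBasis T) fun U hU => ?_
    rw [dense_iff_inter_open]
    intro W hW hWne
    obtain ⟨k, x, hxW, hxU⟩ :=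
      h U W (hopen hU) (TopologicalSpace.nonempty_of_mem_countableBasis hU) hW hWne
    exact ⟨x, hxW, Set.mem_iUnion.mpr ⟨k, hxU⟩⟩
  obtain ⟨x, hx⟩ := hdense.nonempty
  refine ⟨x, (TopologicalSpace.isBasis_countableBasis T).dense_iff.mpr fun U hU _ => ?_⟩
  obtain ⟨k, hk⟩ := Set.mem_iUnion.mp (Set.mem_iInter₂.mp hx U hU)
  exact ⟨_, hk, k, rfl⟩

section EdgeShift

open Relation

variable {G : FinGraph}

lemma IsIrreducible.stronglyConnected (h : IsIrreducible (edgeShift G))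
    (hV : ∀ v, ∃ z : (edgeShift G).carrier, G.src (z.1 0) = v) : G.StronglyConnected := by
  obtain ⟨z, hz⟩ := h
  have hvisit (s : ℕ) (v : G.V) : ∃ k : ℕ, s ≤ k ∧ G.src (z.1 k) = v := by
    obtain ⟨a, ha⟩ := hV v
    have hopen : IsOpen {x : (edgeShift G).carrier | G.src (x.1 s) = v} :=
      (isOpen_discrete {e | G.src e = v}).preimage (continuous_coord _ (s : ℤ))
    obtain ⟨_, hx, k, rfl⟩ := hz.inter_open_nonempty _ hopen
      ⟨translate _ (-s) a, by simpa using ha⟩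
    exact ⟨k + s, by omega, by simpa [iterate_shiftMap] using hx⟩
  intro v w
  obtain ⟨k, -, rfl⟩ := hvisit 0 v
  obtain ⟨l, hl, rfl⟩ := hvisit k w
  induction l, hl using Nat.le_induction with
  | base => exact ReflTransGen.refl
  | succ l _ ih => exact ih.tail ⟨z.1 l, rfl, mod_cast z.2 l⟩

-- Only the left half of `a`, ending at time `-1`, needs to be a path, so that the induction can
-- prolong it by the first edge of the connecting path.
lemma FinGraph.Reachable.exists_glue {v w : G.V} (h : G.Reachable v w) {a : ℤ → G.E}
    (ha : ∀ i < -1, G.tgt (a i) = G.src (a (i + 1))) (hv : G.tgt (a (-1)) = v)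
    (b : (edgeShift G).carrier) (hw : G.src (b.1 0) = w) :
    ∃ (k : ℕ) (x : (edgeShift G).carrier), (∀ i < 0, x.1 i = a i) ∧
      ∀ i ≥ 0, x.1 (k + i) = b.1 i := by
  induction h using ReflTransGen.head_induction_on generalizing a with
  | refl =>
    refine ⟨0, ⟨fun i => if i < 0 then a i else b.1 i, fun i => ?_⟩, fun i hi => ?_,
      fun i hi => ?_⟩
    · rcases lt_trichotomy i (-1) with hi | rfl | hi
      · simpa [show i < 0 by omega, show i + 1 < 0 by omega] using ha i hi
      · simp [hv, hw]
      · simpa [show ¬ i < 0 by omega, show ¬ i + 1 < 0 by omega] using b.2 i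
    · simp [hi]
    · simp [show ¬ i < 0 by omega]
  | head hs _ ih =>
    obtain ⟨e, rfl, rfl⟩ := hs
    obtain ⟨k, x, hxa, hxb⟩ := ih (a := fun i => if i < -1 then a (i + 1) else e)
      (fun i hi => by
        rcases (show i < -2 ∨ i = -2 by omega) with hi' | rfl
        · simpa [hi, show i + 1 < -1 by omega] using ha (i + 1) (by omega)
        · simpa using hv)
      (by simp)
    refine ⟨k + 1, translate _ (-1) x, fun i hi => ?_, fun i hi => ?_⟩
    · simp [hxa (-1 + i) (by omega), show -1 + i < -1 by omega]
    · rw [translate_apply, ← hxb i hi]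
      push_cast
      ring_nf

lemma FinGraph.StronglyConnected.exists_eqOn_window (hG : G.StronglyConnected)
    (a b : (edgeShift G).carrier) (r : ℕ) :
    ∃ (k : ℕ) (x : (edgeShift G).carrier), Set.EqOn x.1 a.1 (window r) ∧
      Set.EqOn (translate _ k x).1 b.1 (window r) := by
  obtain ⟨k, x, hxa, hxb⟩ := (hG (G.tgt (a.1 r)) (G.src (b.1 (-r)))).exists_glue
    (a := (translate _ (r + 1) a).1) (fun i _ => (translate _ _ a).2 i) (by simp)
    (translate _ (-r) b) (by simp)
  refine ⟨k + 2 * r + 1, translate _ (-(r + 1)) x, fun j hj => ?_, fun j hj => ?_⟩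
  · rw [translate_apply, hxa _ (by have := hj.2; omega), translate_apply]
    ring_nf
  · have hb := hxb (r + j) (by have := hj.1; omega)
    rw [translate_apply, neg_add_cancel_left] at hb
    rw [← hb, translate_translate, translate_apply]
    push_cast
    ring_nf

lemma FinGraph.StronglyConnected.isIrreducible (hG : G.StronglyConnected)
    [Nonempty (edgeShift G).carrier] : IsIrreducible (edgeShift G) := by
  refine exists_dense_range_iterate (continuous_translate 1) fun U W hU ⟨b, hb⟩ hW ⟨a, ha⟩ => ?_
  obtain ⟨r₁, h₁⟩ := exists_window_forall_mem_of_isOpen continuous_subtype_val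
    Subtype.val_injective hU hb
  obtain ⟨r₂, h₂⟩ := exists_window_forall_mem_of_isOpen continuous_subtype_val
    Subtype.val_injective hW ha
  obtain ⟨k, x, hxa, hxb⟩ := hG.exists_eqOn_window a b (max r₁ r₂)
  refine ⟨k, x, h₂ x (hxa.mono (window_mono (le_max_right _ _))), h₁ _ ?_⟩
  rw [iterate_shiftMap]
  exact hxb.mono (window_mono (le_max_left _ _))

end EdgeShift

section HigherBlocks

/-- The word of length `n` that starts at coordinate `0`. -/
def word {A : Type*} (n : ℕ) (x : ℤ → A) : Fin n → A := fun j => x j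

/-- The higher block presentation of an edge shift: the vertices are the words of length `m + 1`
that occur in it, the edges those of length `m + 2`, and an edge leads from its first `m + 1`
letters to its last `m + 1` letters. -/
def FinGraph.higherBlock (G : FinGraph) (m : ℕ) : FinGraph where
  V := Set.range fun y : (edgeShift G).carrier => word (m + 1) y.1
  E := Set.range fun y : (edgeShift G).carrier => word (m + 2) y.1
  finiteV := inferInstance
  finiteE := inferInstance
  src w := ⟨Fin.init w.1, by
    obtain ⟨_, y, rfl⟩ := w
    exact ⟨y, rfl⟩⟩
  tgt w := ⟨Fin.tail w.1, by
    obtain ⟨_, y, rfl⟩ := w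
    exact ⟨translate _ 1 y, by ext j; simp [word, Fin.tail, add_comm]⟩⟩

/-- The higher block code, which reads words of length `m + 2`. -/
def higherBlockCode (G : FinGraph) (m : ℕ) (y : (edgeShift G).carrier) :
    (edgeShift (G.higherBlock m)).carrier :=
  ⟨fun t => ⟨word (m + 2) (translate _ t y).1, translate _ t y, rfl⟩, fun t => Subtype.ext <| by
    ext j
    simp [FinGraph.higherBlock, word, Fin.tail, Fin.init, add_right_comm, add_assoc]⟩

variable {G : FinGraph} {m : ℕ}

lemma higherBlockCode_apply (y : (edgeShift G).carrier) (t : ℤ) (j : Fin (m + 2)) :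
    ((higherBlockCode G m y).1 t).1 j = y.1 (t + j) := rfl

lemma isCode_higherBlockCode : IsCode (higherBlockCode G m) := by
  refine ⟨Continuous.subtype_mk (continuous_pi fun t => ?_) _, fun y => ?_⟩
  · have hval : Continuous fun y : (edgeShift G).carrier =>
        ((higherBlockCode G m y).1 t).1 :=
      continuous_pi fun j => continuous_coord _ (t + j)
    refine continuous_discrete_rng.mpr fun w => ?_
    convert (isOpen_discrete {w.1}).preimage hval using 1
    ext y
    exact Subtype.ext_iff
  · ext t : 2
    refine Subtype.ext (funext fun j => ?_)
    simp [higherBlockCode_apply, shiftMap_eq_translate, add_assoc]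

lemma apply_eq_apply_zero (z : (edgeShift (G.higherBlock m)).carrier) (t : ℤ) (j : Fin (m + 2)) :
    (z.1 t).1 j = (z.1 (t + j)).1 0 := by
  induction j using Fin.induction generalizing t with
  | zero => simp
  | succ j ih =>
    have hstep : (z.1 t).1 j.succ = (z.1 (t + 1)).1 j.castSucc :=
      congrFun (congrArg Subtype.val (z.2 t)) j
    rw [hstep, ih]
    simp [add_right_comm, add_assoc]

lemma bijective_higherBlockCode : Function.Bijective (higherBlockCode G m) := by
  refine ⟨fun y y' h => Subtype.ext (funext fun t => ?_), fun z => ?_⟩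
  · simpa [higherBlockCode_apply] using congrArg (fun z => (z.1 t).1 0) h
  · refine ⟨⟨fun t => (z.1 t).1 0, fun t => ?_⟩, ?_⟩
    · obtain ⟨y, hy⟩ := (z.1 t).2
      have hnext : (z.1 (t + 1)).1 0 = y.1 1 := by
        simpa [← hy, word] using (apply_eq_apply_zero z t 1).symm
      exact (congrArg G.tgt (congrFun hy 0).symm).trans
        ((y.2 0).trans (congrArg G.src hnext.symm))
    · ext t : 2
      exact Subtype.ext (funext fun j => (apply_eq_apply_zero z t j).symm)

lemma IsIrreducible.stronglyConnected_higherBlock (h : IsIrreducible (edgeShift G)) (m : ℕ) :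
    (G.higherBlock m).StronglyConnected := by
  refine (h.of_surjective isCode_higherBlockCode
    bijective_higherBlockCode.surjective).stronglyConnected ?_
  rintro ⟨_, y, rfl⟩
  exact ⟨higherBlockCode G m y, Subtype.ext (funext fun j => congrArg y.1 (zero_add _))⟩

lemma exists_stronglyConnected_presentation {C : Type*} [TopologicalSpace C]
    [DiscreteTopology C] [Finite C] {Y : Subshift C ℤ} (hY : IsSFT Y) (hYirr : IsIrreducible Y)
    (m : ℕ) : ∃ (H : FinGraph) (χ : Y.carrier → (edgeShift H).carrier), IsCode χ ∧
      Function.Bijective χ ∧ H.StronglyConnected ∧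
      ∀ y y', (χ y).1 0 = (χ y').1 0 → Set.EqOn y.1 y'.1 (window m) := by
  obtain ⟨G, χ, hχ, hb⟩ := hY
  obtain ⟨r, hr⟩ := exists_window_eq_of_factorsThrough
    (continuous_subtype_val.comp hχ.continuous)
    ((Pi.continuous_domRestrict (window m)).comp continuous_subtype_val)
    (fun y y' h => by rw [hb.injective (Subtype.ext h)])
  have hcode : IsCode (higherBlockCode G (2 * r) ∘ χ ∘ translate Y (-r)) :=
    isCode_higherBlockCode.comp (hχ.comp (isCode_translate _))
  refine ⟨G.higherBlock (2 * r), _, hcode,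
    bijective_higherBlockCode.comp (hb.comp (bijective_translate _)),
    (hYirr.of_surjective hχ hb.surjective).stronglyConnected_higherBlock _, fun y y' h => ?_⟩
  refine Set.domRestrict_eq_domRestrict_iff.mp (hr y y' fun j ⟨hj, hj'⟩ => ?_)
  have hw := congrFun (congrArg Subtype.val h) ⟨(j + r).toNat, by omega⟩
  simpa [higherBlockCode_apply, hχ.map_translate, show max (j + r) 0 = j + r by omega] using hw

end HigherBlocks

section SkewProjection

lemma existsUnique_orbit {L : Type*} (p : ℤ → Equiv.Perm L) (i : L) :
    ∃! s : ℤ → L, s 0 = i ∧ ∀ t, p t (s t) = s (t + 1) := by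
  let s : ℤ → L
    | Int.ofNat k => k.rec i fun k a => p k a
    | Int.negSucc k =>
      k.rec ((p (Int.negSucc 0)).symm i) fun k a => (p (Int.negSucc (k + 1))).symm a
  have hs (t : ℤ) : p t (s t) = s (t + 1) := by
    match t with
    | Int.ofNat _ => rfl
    | Int.negSucc 0 => exact (p _).apply_symm_apply i
    | Int.negSucc (k + 1) => exact (p _).apply_symm_apply (s (Int.negSucc k))
  refine ⟨s, ⟨rfl, hs⟩, fun s' ⟨h0, hs'⟩ => funext fun t => ?_⟩
  induction t using Int.induction_on with
  | zero => exact h0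
  | succ t ih => rw [← hs', ← hs, ih]
  | pred t ih =>
    rw [← sub_add_cancel (-(t : ℤ)) 1, ← hs', ← hs] at ih
    exact (p _).injective ih

variable {G : FinGraph} {L : Type} [Finite L] {π : G.E → Equiv.Perm L}

lemma mem_edgeShift_skewProduct {z : ℤ → G.E × L} :
    z ∈ (edgeShift (G.skewProduct π)).carrier ↔
      ∀ t, G.tgt (z t).1 = G.src (z (t + 1)).1 ∧ π (z t).1 (z t).2 = (z (t + 1)).2 :=
  forall_congr' fun _ => Prod.mk_inj

/-- The covering map from the edge shift of a skew product to the edge shift of the base graph. -/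
def skewProj (π : G.E → Equiv.Perm L) (z : (edgeShift (G.skewProduct π)).carrier) :
    (edgeShift G).carrier :=
  ⟨fun t => (z.1 t).1, fun t => (mem_edgeShift_skewProduct.mp z.2 t).1⟩

lemma isCode_skewProj : IsCode (skewProj π) := by
  refine ⟨Continuous.subtype_mk (continuous_pi fun t => ?_) _, fun z => rfl⟩
  exact (continuous_of_discreteTopology (f := fun p : (G.skewProduct π).E => p.1)).comp
    (continuous_coord _ t)

lemma encard_skewProj_fiber (y : (edgeShift G).carrier) :
    (skewProj π ⁻¹' {y}).encard = Nat.card L := by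
  have hbij : Set.BijOn (fun z : (edgeShift (G.skewProduct π)).carrier => (z.1 0).2)
      (skewProj π ⁻¹' {y}) Set.univ := by
    refine ⟨Set.mapsTo_univ _ _, fun z hz z' hz' h0 => ?_, fun i _ => ?_⟩
    · have hfst (t : ℤ) : (z.1 t).1 = y.1 t := congrFun (congrArg Subtype.val hz) t
      have hfst' (t : ℤ) : (z'.1 t).1 = y.1 t := congrFun (congrArg Subtype.val hz') t
      have hsnd := (existsUnique_orbit (fun t => π (y.1 t)) (z.1 0).2).unique
        (y₁ := fun t => (z.1 t).2) (y₂ := fun t => (z'.1 t).2)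
        ⟨rfl, fun t => hfst t ▸ (mem_edgeShift_skewProduct.mp z.2 t).2⟩
        ⟨h0.symm, fun t => hfst' t ▸ (mem_edgeShift_skewProduct.mp z'.2 t).2⟩
      exact Subtype.ext (funext fun t =>
        Prod.ext ((hfst t).trans (hfst' t).symm) (congrFun hsnd t))
    · obtain ⟨s, ⟨hs0, hs⟩, -⟩ := existsUnique_orbit (fun t => π (y.1 t)) i
      exact ⟨⟨fun t => (y.1 t, s t), mem_edgeShift_skewProduct.mpr fun t => ⟨y.2 t, hs t⟩⟩,
        rfl, hs0⟩
  rw [← hbij.injOn.encard_image, hbij.image_eq, Set.encard_univ, ENat.card_eq_coe_natCard]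

lemma exists_lift_skewProj {A : Type*} [TopologicalSpace A] {X : Subshift A ℤ}
    [TopologicalSpace L] [DiscreteTopology L] {α : X.carrier → (edgeShift G).carrier}
    (hα : IsCode α) {l : X.carrier → L} (hl : Continuous l)
    (h : ∀ x, π ((α x).1 0) (l x) = l (shiftMap X x)) :
    ∃ ψ : X.carrier → (edgeShift (G.skewProduct π)).carrier, IsCode ψ ∧
      (∀ x, skewProj π (ψ x) = α x) ∧ ∀ x, ((ψ x).1 0).2 = l x := by
  refine ⟨fun x => ⟨fun t => ((α x).1 t, l (translate X t x)),
    mem_edgeShift_skewProduct.mpr fun t => ⟨(α x).2 t, ?_⟩⟩, ⟨?_, fun x => ?_⟩, fun x => rfl,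
    fun x => congrArg l (translate_zero x)⟩
  · simpa [hα.map_translate, shiftMap_eq_translate, translate_translate] using h (translate X t x)
  · refine Continuous.subtype_mk (continuous_pi fun t => ?_) _
    exact (continuous_of_discreteTopology (α := G.E × L) (β := (G.skewProduct π).E)
      (f := id)).comp (((continuous_coord _ t).comp hα.continuous).prodMk
        (hl.comp (continuous_translate t)))
  · refine Subtype.ext (funext fun t => Prod.ext ?_ ?_)
    · simp [shiftMap_eq_translate, hα.map_translate]
    · simp [shiftMap_eq_translate, translate_translate]

end SkewProjection

section Labellings

variable {A C L : Type*} [TopologicalSpace A] [Finite A] [TopologicalSpace C] [T2Space C]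
  [TopologicalSpace L] {X : Subshift A ℤ} {Y : Subshift C ℤ} {φ : X.carrier → Y.carrier}

lemma exists_window_forall_not_eqOn_of_not_surjective (hφ : IsCode φ)
    (hns : ¬ Function.Surjective φ) :
    ∃ (y₀ : Y.carrier) (r : ℕ), ∀ x, ¬ Set.EqOn (φ x).1 y₀.1 (window r) := by
  obtain ⟨y₀, hy₀⟩ := not_forall.mp hns
  obtain ⟨r, hr⟩ := exists_window_forall_not_eqOn (continuous_subtype_val.comp hφ.continuous)
    (g := fun _ => y₀.1) continuous_const isClosed_univ
    (fun x _ he => hy₀ ⟨x, Subtype.ext he⟩)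
  exact ⟨y₀, r, fun x => hr x trivial⟩

variable [DiscreteTopology L] {l : X.carrier → L}

lemma IsFiberLabelling.exists_window_apply_eq_iff (hφ : IsCode φ) (hl : IsFiberLabelling φ l) :
    ∃ r : ℕ, ∀ x x', Set.EqOn (φ x).1 (φ x').1 (window r) →
      (l x = l x' ↔ l (shiftMap X x) = l (shiftMap X x')) := by
  have hiff (x x' : X.carrier) (h : φ x = φ x') :
      l x = l x' ↔ l (shiftMap X x) = l (shiftMap X x') := by
    rw [(hl.injOn (φ x')).eq_iff h rfl, (hl.injOn (φ (shiftMap X x'))).eq_iff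
      (by simp [hφ.comm, h]) rfl, shiftMap_eq_translate, (bijective_translate 1).injective.eq_iff]
  have hcont := hφ.continuous
  have hlcont := hl.continuous
  obtain ⟨r, hr⟩ := exists_window_forall_not_eqOn (T := X.carrier × X.carrier)
    (f := fun p => (φ p.1).1) (g := fun p => (φ p.2).1) (by fun_prop) (by fun_prop)
    (S := {p | ¬ (l p.1 = l p.2 ↔ l (shiftMap X p.1) = l (shiftMap X p.2))})
    ((isClosed_discrete {q : (L × L) × (L × L) | ¬ (q.1.1 = q.1.2 ↔ q.2.1 = q.2.2)}).preimage
      (f := fun p : X.carrier × X.carrier =>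
        ((l p.1, l p.2), (l (shiftMap X p.1), l (shiftMap X p.2))))
      (by simp only [shiftMap_eq_translate]; fun_prop))
    (fun p hp he => hp (hiff _ _ (Subtype.ext he)))
  exact ⟨r, fun x x' h => by_contra fun hne => hr (x, x') hne h⟩

end Labellings

section SkewPresentation

lemma IsFiberLabelling.exists_skewProduct_presentation {A C : Type*} {L : Type}
    [TopologicalSpace A] [Finite A] [TopologicalSpace C] [DiscreteTopology C] [Finite C]
    [TopologicalSpace L] [DiscreteTopology L] [Finite L] {X : Subshift A ℤ} {Y : Subshift C ℤ}
    (hY : IsSFT Y) (hYirr : IsIrreducible Y) {φ : X.carrier → Y.carrier} (hφ : IsCode φ)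
    (hns : ¬ Function.Surjective φ) {l : X.carrier → L} (hl : IsFiberLabelling φ l) :
    ∃ (H : FinGraph) (χ : Y.carrier → (edgeShift H).carrier) (π : H.E → Equiv.Perm L),
      IsCode χ ∧ Function.Bijective χ ∧ (H.skewProduct π).StronglyConnected ∧
      ∀ x, π ((χ (φ x)).1 0) (l x) = l (shiftMap X x) := by
  obtain ⟨r, hr⟩ := hl.exists_window_apply_eq_iff hφ
  obtain ⟨y₀, s, hs⟩ := exists_window_forall_not_eqOn_of_not_surjective hφ hns
  obtain ⟨H, χ, hχ, hχb, hH, hwindow⟩ := exists_stronglyConnected_presentation hY hYirr (max r s)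
  obtain ⟨π, hπ, hconn⟩ := hH.exists_stronglyConnected_skewProduct
    (R := fun e i j => ∃ x, (χ (φ x)).1 0 = e ∧ l x = i ∧ l (shiftMap X x) = j)
    (fun e => by
      have hiff {x x' : X.carrier} (hx : (χ (φ x)).1 0 = e) (hx' : (χ (φ x')).1 0 = e) :=
        hr x x' ((hwindow _ _ (hx.trans hx'.symm)).mono (window_mono (le_max_left r s)))
      constructor
      · rintro i j i' ⟨x, hx, rfl, rfl⟩ ⟨x', hx', rfl, h⟩
        exact (hiff hx hx').mpr h.symm
      · rintro i j j' ⟨x, hx, rfl, rfl⟩ ⟨x', hx', h, rfl⟩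
        exact (hiff hx hx').mp h.symm)
    (e₀ := (χ y₀).1 0)
    (fun i j ⟨x, hx, _⟩ => hs x ((hwindow _ _ hx).mono (window_mono (le_max_right r s))))
  exact ⟨H, χ, π, hχ, hχb, hconn, fun x => hπ _ _ _ ⟨x, rfl, rfl, rfl⟩⟩

end SkewPresentation

section Recoding

lemma exists_isCode_bijective_of_separating {B D : Type*} [TopologicalSpace B] [T2Space B]
    [TopologicalSpace D] [Finite D] {Z : Subshift D ℤ} {c : Z.carrier → B} (hc : Continuous c)
    (hsep : ∀ z z', (∀ t, c (translate Z t z) = c (translate Z t z')) → z.1 0 = z'.1 0) :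
    ∃ (X' : Subshift B ℤ) (θ : Z.carrier → X'.carrier), IsCode θ ∧ Function.Bijective θ ∧
      ∀ z t, (θ z).1 t = c (translate Z t z) := by
  let Θ : Z.carrier → ℤ → B := fun z t => c (translate Z t z)
  have hΘ : Continuous Θ := by fun_prop
  have hshift (s : ℤ) (z : Z.carrier) : shift s (Θ z) = Θ (translate Z s z) := by
    funext t
    simp [Θ, translate_translate]
  have hinj : Function.Injective Θ := fun z z' h => by
    ext t
    simpa using hsep (translate Z t z) (translate Z t z')
      (congrFun (by rw [← hshift, h, hshift] : Θ (translate Z t z) = Θ (translate Z t z')))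
  refine ⟨⟨Set.range Θ, (isCompact_range hΘ).isClosed, ?_⟩, Set.rangeFactorization Θ,
    ⟨hΘ.subtype_mk _, fun z => Subtype.ext (hshift 1 z).symm⟩,
    ⟨fun z z' h => hinj (congrArg Subtype.val h), Set.rangeFactorization_surjective⟩,
    fun z t => rfl⟩
  rintro s _ ⟨z, rfl⟩
  exact ⟨translate Z s z, (hshift s z).symm⟩

variable {A D : Type*} [TopologicalSpace A] [Finite A] [TopologicalSpace D]
  {X : Subshift A ℤ} {Z : Subshift D ℤ} {ψ : X.carrier → Z.carrier}

lemma exists_isLocallyConstant_apply_eq_some [DiscreteTopology A] [DiscreteTopology D] [Finite D]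
    (hψ : Continuous ψ) (hinj : Function.Injective ψ) :
    ∃ g : Z.carrier → Option A, IsLocallyConstant g ∧ ∀ x, g (ψ x) = some (x.1 0) := by
  obtain ⟨r, hr⟩ := exists_window_eq_of_factorsThrough (continuous_subtype_val.comp hψ)
    (continuous_coord X 0) (fun x x' h => by rw [hinj (Subtype.ext h)])
  let block : Z.carrier → window r → D := fun z => (window r).domRestrict z.1
  have hblock : IsLocallyConstant block := (IsLocallyConstant.iff_continuous _).mpr
    ((Pi.continuous_domRestrict (window r)).comp continuous_subtype_val)
  refine ⟨_, hblock.comp (Function.extend (block ∘ ψ) (fun x => some (x.1 0)) fun _ => none),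
    fun x => Function.FactorsThrough.extend_apply (fun x x' h => ?_) _ x⟩
  exact congrArg some (hr x x' (Set.domRestrict_eq_domRestrict_iff.mp h))

-- Compactness: the conclusion holds on the image of `ψ`, hence near it.
lemma exists_window_apply_zero_eq [DiscreteTopology D] [Finite D] {E : Type*}
    [TopologicalSpace E] [T2Space E] (hψ : IsCode ψ) {g : Z.carrier → E} (hg : Continuous g)
    (hsep : ∀ x x', (∀ t, g (translate Z t (ψ x)) = g (translate Z t (ψ x'))) → ψ x = ψ x') :
    ∃ M : ℕ, ∀ z z' x x', Set.EqOn z.1 (ψ x).1 (window M) → Set.EqOn z'.1 (ψ x').1 (window M) →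
      (∀ t ∈ window M, g (translate Z t z) = g (translate Z t z')) → z.1 0 = z'.1 0 := by
  have hcont := hψ.continuous
  have hcoord := continuous_coord Z
  obtain ⟨M, hM⟩ := exists_window_forall_not_eqOn
    (T := (Z.carrier × Z.carrier) × (X.carrier × X.carrier))
    (f := fun p t => (p.1.1.1 t, p.1.2.1 t, g (translate Z t p.1.1)))
    (g := fun p t => ((ψ p.2.1).1 t, (ψ p.2.2).1 t, g (translate Z t p.1.2)))
    (continuous_pi fun t => .prodMk ((hcoord t).comp (by fun_prop))
      (.prodMk ((hcoord t).comp (by fun_prop)) (by fun_prop)))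
    (continuous_pi fun t => .prodMk ((hcoord t).comp (by fun_prop))
      (.prodMk ((hcoord t).comp (by fun_prop)) (by fun_prop)))
    (S := {p | p.1.1.1 0 ≠ p.1.2.1 0})
    ((isClosed_discrete {q : D × D | q.1 ≠ q.2}).preimage
      (((hcoord 0).prodMap (hcoord 0)).comp continuous_fst))
    (fun ⟨⟨z, z'⟩, x, x'⟩ hp he => by
      simp only [funext_iff, Prod.mk.injEq, forall_and] at he
      obtain ⟨hz, hz', ht⟩ := he
      obtain rfl : z = ψ x := Subtype.ext (funext hz)
      obtain rfl : z' = ψ x' := Subtype.ext (funext hz')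
      exact hp (by rw [hsep x x' ht]))
  exact ⟨M, fun z z' x x' hz hz' ht => by_contra fun hne => hM ((z, z'), x, x') hne
    fun t htM => Prod.ext (hz htM) (Prod.ext (hz' htM) (ht t htM))⟩

lemma exists_separating_coding {A : Type u} [TopologicalSpace A] [DiscreteTopology A] [Finite A]
    {D : Type} [TopologicalSpace D] [DiscreteTopology D] [Finite D]
    {X : Subshift A ℤ} {Z : Subshift D ℤ} {ψ : X.carrier → Z.carrier} (hψ : IsCode ψ)
    (hinj : Function.Injective ψ) :
    ∃ (B : Type u) (_ : Finite B) (_ : TopologicalSpace B) (_ : DiscreteTopology B) (ι : A ↪ B)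
      (c : Z.carrier → B), Continuous c ∧ (∀ x, c (ψ x) = ι (x.1 0)) ∧
      ∀ z z', (∀ t, c (translate Z t z) = c (translate Z t z')) → z.1 0 = z'.1 0 := by
  classical
  let _ : TopologicalSpace (Option A) := ⊥
  have _ : DiscreteTopology (Option A) := ⟨rfl⟩
  obtain ⟨g, hg, hgψ⟩ := exists_isLocallyConstant_apply_eq_some hψ.continuous hinj
  have hread (x : X.carrier) (t : ℤ) : g (translate Z t (ψ x)) = some (x.1 t) := by
    simp [← hψ.map_translate, hgψ]
  obtain ⟨M, hM⟩ := exists_window_apply_zero_eq hψ hg.continuous fun x x' h =>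
    congrArg ψ (Subtype.ext (funext fun t => Option.some_injective _ (by rw [← hread, h, hread])))
  let block : Z.carrier → window M → D := fun z => (window M).domRestrict z.1
  have hblock : Continuous block :=
    (Pi.continuous_domRestrict (window M)).comp continuous_subtype_val
  -- Points that look like a point `ψ x` on the window are coded by `g`, which reads off `x`, all
  -- others by their block.
  let code (a : Option A) (w : window M → D) : Option A ⊕ ULift.{u} (window M → D) :=
    if w ∈ Set.range (block ∘ ψ) then .inl a else .inr ⟨w⟩
  let _ : TopologicalSpace (Option A ⊕ ULift.{u} (window M → D)) := ⊥
  refine ⟨Option A ⊕ ULift.{u} (window M → D), inferInstance, ⊥, ⟨rfl⟩,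
    (Function.Embedding.some).trans .inl, fun z => code (g z) (block z), ?_, fun x => ?_,
    fun z z' h => ?_⟩
  · exact (continuous_of_discreteTopology (f := fun q : Option A × (window M → D) =>
      code q.1 q.2)).comp (hg.continuous.prodMk hblock)
  · exact (if_pos ⟨x, rfl⟩).trans (congrArg Sum.inl (hgψ x))
  by_cases hall : ∀ t ∈ window M, block (translate Z t z) ∈ Set.range (block ∘ ψ) ∧
      block (translate Z t z') ∈ Set.range (block ∘ ψ)
  · obtain ⟨⟨x, hx⟩, x', hx'⟩ := hall 0 (by simp)
    rw [translate_zero] at hx hx'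
    refine hM z z' x x' (Set.domRestrict_eq_domRestrict_iff.mp hx.symm)
      (Set.domRestrict_eq_domRestrict_iff.mp hx'.symm) fun t ht => ?_
    simpa only [code, if_pos (hall t ht).1, if_pos (hall t ht).2, Sum.inl.injEq] using h t
  · push Not at hall
    obtain ⟨t, ht, hnot⟩ := hall
    have heq : block (translate Z t z) = block (translate Z t z') := by
      have hcode := h t
      simp only [code] at hcode
      split_ifs at hcode <;> simp_all
    simpa using Set.domRestrict_eq_domRestrict_iff.mp heq (x := -t) ⟨by grind, by grind⟩

lemma exists_recoding {A : Type u} [TopologicalSpace A] [DiscreteTopology A] [Finite A]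
    {D : Type} [TopologicalSpace D] [DiscreteTopology D] [Finite D]
    {X : Subshift A ℤ} {Z : Subshift D ℤ} {ψ : X.carrier → Z.carrier} (hψ : IsCode ψ)
    (hinj : Function.Injective ψ) :
    ∃ (B : Type u) (_ : Finite B) (_ : TopologicalSpace B) (_ : DiscreteTopology B) (ι : A ↪ B)
      (X' : Subshift B ℤ) (θ : Z.carrier → X'.carrier), IsCode θ ∧ Function.Bijective θ ∧
      ∀ x, (θ (ψ x)).1 = ι ∘ x.1 := by
  obtain ⟨B, hB, tB, dB, ι, c, hc, hcψ, hsep⟩ := exists_separating_coding hψ hinj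
  obtain ⟨X', θ, hθ, hb, hθc⟩ := exists_isCode_bijective_of_separating hc hsep
  refine ⟨B, hB, tB, dB, ι, X', θ, hθ, hb, fun x => funext fun t => ?_⟩
  simp [hθc, ← hψ.map_translate, hcψ]

end Recoding

section Extension

lemma hasIrreducibleExtension_of_injective {A : Type u} [TopologicalSpace A] [DiscreteTopology A]
    [Finite A] {D : Type} [TopologicalSpace D] [DiscreteTopology D] [Finite D] {C : Type v}
    [TopologicalSpace C] {X : Subshift A ℤ} {Z : Subshift D ℤ} {Y : Subshift C ℤ}
    {ψ : X.carrier → Z.carrier} {p : Z.carrier → Y.carrier} {φ : X.carrier → Y.carrier} {n : ℕ}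
    (hZ : IsSFT Z) (hZirr : IsIrreducible Z) (hψ : IsCode ψ) (hinj : Function.Injective ψ)
    (hp : IsCode p) (hpψ : ∀ x, p (ψ x) = φ x) (hs : Function.Surjective p)
    (hn : ∀ y, (p ⁻¹' {y}).encard = n) : HasIrreducibleExtension φ n := by
  obtain ⟨G, κ, hκ, hκb⟩ := hZ
  obtain ⟨B, hB, tB, dB, ι, X', θ, hθ, hθb, hθψ⟩ := exists_recoding hψ hinj
  obtain ⟨ρ, hρ, hρθ, hθρ⟩ := hθ.exists_inverse hθb
  have hρb : Function.Bijective ρ := ⟨hθρ.injective, hρθ.surjective⟩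
  refine ⟨B, hB, tB, dB, ι, X', fun x hx => hθψ ⟨x, hx⟩ ▸ (θ (ψ ⟨x, hx⟩)).2, p ∘ ρ,
    ⟨G, κ ∘ ρ, hκ.comp hρ, hκb.comp hρb⟩, hZirr.of_surjective hθ hθb.surjective, hp.comp hρ,
    fun x => ?_, hs.comp hρb.surjective, fun y => ?_⟩
  · rw [← hpψ, ← hρθ (ψ x)]
    exact congrArg (p ∘ ρ) (Subtype.ext (hθψ x).symm)
  · rw [Set.preimage_comp, Set.encard_preimage_of_bijective hρb, hn]

lemma IsFiberLabelling.hasIrreducibleExtension {A : Type u} [TopologicalSpace A]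
    [DiscreteTopology A] [Finite A] {C : Type v} [TopologicalSpace C] [DiscreteTopology C]
    [Finite C] {L : Type} [TopologicalSpace L] [DiscreteTopology L] [Finite L] [Nonempty L]
    {X : Subshift A ℤ} {Y : Subshift C ℤ} (hY : IsSFT Y) (hYirr : IsIrreducible Y)
    {φ : X.carrier → Y.carrier} (hφ : IsCode φ) (hns : ¬ Function.Surjective φ)
    {l : X.carrier → L} (hl : IsFiberLabelling φ l) : HasIrreducibleExtension φ (Nat.card L) := by
  obtain ⟨H, χ, π, hχ, hχb, hconn, hπ⟩ := hl.exists_skewProduct_presentation hY hYirr hφ hns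
  obtain ⟨ψ, hψ, hproj, hlabel⟩ := exists_lift_skewProj (hχ.comp hφ) hl.continuous hπ
  obtain ⟨ρ, hρ, hρχ, hχρ⟩ := hχ.exists_inverse hχb
  have hcard (y : Y.carrier) : (ρ ∘ skewProj π ⁻¹' {y}).encard = Nat.card L := by
    have hpre : ρ ⁻¹' {y} = {χ y} := by
      ext w
      exact ⟨fun h => (hχρ w).symm.trans (congrArg χ h), fun h => (congrArg ρ h).trans (hρχ y)⟩
    rw [Set.preimage_comp, hpre, encard_skewProj_fiber]
  have hs : Function.Surjective (ρ ∘ skewProj π) := fun y =>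
    Set.preimage_singleton_nonempty.mp (Set.encard_ne_zero.mp
      (by rw [hcard]; exact_mod_cast Nat.card_pos.ne'))
  have : Nonempty (edgeShift (H.skewProduct π)).carrier := ⟨(hs hYirr.choose).choose⟩
  refine hasIrreducibleExtension_of_injective ⟨_, id, ⟨continuous_id, fun _ => rfl⟩,
    Function.bijective_id⟩ hconn.isIrreducible hψ (fun x x' h => ?_) (hρ.comp isCode_skewProj)
    (fun x => ?_) hs hcard
  · refine hl.injOn (φ x') (hχb.injective ?_) rfl ?_
    · exact (hproj x).symm.trans ((congrArg (skewProj π) h).trans (hproj x'))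
    · rw [← hlabel, h, hlabel]
  · exact (congrArg ρ (hproj x)).trans (hρχ (φ x))

end Extension

end BiclosingExtension

open BiclosingExtension in
theorem theorem4p3_general {A : Type*} [TopologicalSpace A] [DiscreteTopology A] [Finite A]
    {C : Type*} [TopologicalSpace C] [DiscreteTopology C] [Finite C]
    {X : Subshift A ℤ} {Y : Subshift C ℤ} (hY : IsSFT Y) (hYirr : IsIrreducible Y)
    {φ : X.carrier → Y.carrier} (hφ : IsCode φ) (hbc : IsBiclosing φ)
    (hns : ¬ Function.Surjective φ) :
    ∃ d : ℕ, IsGreatest (Set.range fun y : Y.carrier => (φ ⁻¹' {y}).encard) (d : ℕ∞) ∧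
      ∀ n : ℕ, d ≤ n → 0 < n → HasIrreducibleExtension φ n := by
  have : Nonempty Y.carrier := ⟨hYirr.choose⟩
  obtain ⟨d, hd⟩ := hbc.exists_isGreatest_encard_fiber hφ
  refine ⟨d, hd, fun n hdn hn => ?_⟩
  have : NeZero n := ⟨hn.ne'⟩
  obtain ⟨l, hl⟩ := hbc.exists_isFiberLabelling hφ (L := Fin n) fun y =>
    (hd.2 ⟨y, rfl⟩).trans (by simpa using hdn)
  simpa using hl.hasIrreducibleExtension hY hYirr hφ hns

theorem theorem4p3 {A : Type*} [TopologicalSpace A] [DiscreteTopology A] [Finite A]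
    {C : Type*} [TopologicalSpace C] [DiscreteTopology C] [Finite C]
    (X : Subshift A ℤ) (Y : Subshift C ℤ)
    (hY : BiclosingExtension.IsSFT Y) (hYirr : BiclosingExtension.IsIrreducible Y)
    (hent : BiclosingExtension.entropy X < BiclosingExtension.entropy Y)
    (φ : X.carrier → Y.carrier) (hφ : BiclosingExtension.IsCode φ)
    (hbc : BiclosingExtension.IsBiclosing φ) :
    -- `d` is the maximal number of preimages of a point of `Y`
    ∃ d : ℕ, IsGreatest (Set.range fun y : Y.carrier => (φ ⁻¹' {y}).encard) (d : ℕ∞) ∧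
      (X.carrier.Nonempty → BiclosingExtension.IsSFT X → BiclosingExtension.IsIndecomposable X →
        ∀ n : ℕ, d ≤ n → BiclosingExtension.HasIrreducibleExtension φ n) ∧
      (BiclosingExtension.IsSFT X →
        ∀ n : ℕ, d + 1 ≤ n → BiclosingExtension.HasIrreducibleExtension φ n) ∧
      (∃ m : ℕ, d ≤ m ∧ ∀ n : ℕ, m ≤ n → BiclosingExtension.HasIrreducibleExtension φ n) := by
  obtain ⟨d, hd, hext⟩ := theorem4p3_general hY hYirr hφ hbc fun hs =>
    (BiclosingExtension.entropy_le_of_surjective hφ hs).not_gt hent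
  refine ⟨d, hd, fun ⟨x, hx⟩ _ _ n hn => hext n hn (lt_of_lt_of_le ?_ hn),
    fun _ n hn => hext n (by omega) (by omega),
    d + 1, by omega, fun n hn => hext n (by omega) (by omega)⟩
  have hpos : 0 < (φ ⁻¹' {φ ⟨x, hx⟩}).encard := Set.encard_pos.mpr ⟨⟨x, hx⟩, rfl⟩
  exact_mod_cast hpos.trans_le (hd.2 ⟨_, rfl⟩)
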